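/- All graphs are finite and simple. A bipartite graph is given with a fixed bipartition into two independent sets (its sides, possibly empty), and isomorphisms of bipartite graphs preserve the (unordered) bipartition. For a graph $G$ and disjoint $A,B\subseteq V(G)$, let $G[A]$ be the induced subgraph, and let $G[A,B]$ be the bipartite graph semi-induced by $A$ and $B$: it has sides $A,B$, and its edges are exactly the edges of $G$ with one endpoint in $A$ and the other in $B$. The graph $G$ excludes a bipartite graph $H$ as a semi-induced subgraph if no $G[A,B]$ is isomorphic to $H$. Let $P_t$ be the path on $t$ vertices with its bipartition into alternating vertices; let $\widetilde{P}_t$ be its bipartite complement (same sides; vertices from different sides are adjacent iff they are non-adjacent in $P_t$); let $H_k$ be the half-graph of order $k$, with sides $\{a_1,\dots,a_k\}$ and $\{b_1,\dots,b_k\}$, where $a_i$ is adjacent to $b_j$ iff $i\le j$. A $c$-colored tree model consists of a rooted tree $T$, a coloring of its leaves with $c$ colors, and a function $f(x,p,q)\in\{0,1\}$ of internal nodes $x$ and colors $p,q$, symmetric in $p,q$. It defines the graph whose vertices are the leaves of $T$, where distinct leaves $u,v$ of colors $p,q$ are adjacent iff $f(u\wedge v,p,q)=1$, with $u\wedge v$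 the least common ancestor. The height of $T$ is the maximum number of edges on a root-to-leaf path. A graph is a cograph of height at most $h$ if it is defined by a $1$-colored tree model of height at most $h$. A bipartite graph is a bi-cograph of height at most $h$ if it is defined by a $2$-colored tree model of height at most $h$ in which the coloring of the leaves is the bipartition. A $2$-cosplit of $G$ of height at most $h$ is a partition $\mathscr{P}$ of $V(G)$ into nonempty parts such that $G[A]$ is a cograph of height at most $h$ for every $A\in\mathscr{P}$, and $G[A,B]$ is a bi-cograph of height at most $h$ for all distinct $A,B\in\mathscr{P}$. Its size is $|\mathscr{P}|$. **Theorem.** For all $t,k\in\mathbb{N}$ there exists $N\in\mathbb{N}$ such that every graph that excludes $P_t$, $\widetilde{P}_t$ and $H_k$ as semi-induced subgraphs admits a $2$-cosplit of size at most $N$ and height at most $4k$. -/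

import Mathlib

universe u v w

namespace Cosplit

open SimpleGraph

/-! ### Bipartite graphs with a fixed bipartition -/

/-- A bipartite graph given together with a fixed bipartition. The two sides are the two colour
classes of `side`; one of them may be empty. -/
structure BipartiteGraph (V : Type u) where
  graph : SimpleGraph V
  side : graph.Coloring Bool

namespace BipartiteGraph

/-- Isomorphism of bipartite graphs: a graph isomorphism that maps the (unordered) bipartition to
the (unordered) bipartition. -/
def Isomorphic {V : Type u} {W : Type v} (H : BipartiteGraph V) (K : BipartiteGraph W) : Prop :=
  ∃ φ : H.graph ≃g K.graph, ∀ x y : V, H.side x = H.side y ↔ K.side (φ x) = K.side (φ y)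

/-- The bipartite complement: same vertex set, same bipartition, and two vertices from different
sides are adjacent iff they were non-adjacent. -/
def bipartiteCompl {V : Type u} (H : BipartiteGraph V) : BipartiteGraph V where
  graph :=
    { Adj := fun x y => H.side x ≠ H.side y ∧ ¬ H.graph.Adj x y
      symm := ⟨fun _ _ h => ⟨h.1.symm, fun h' => h.2 h'.symm⟩⟩
      loopless := ⟨fun _ h => h.1 rfl⟩ }
  side := Coloring.mk H.side (fun h => h.1)

/-- The path `P_t` on `t` vertices `0, 1, …, t - 1`, with its bipartition into even and odd
vertices. -/
def path (t : ℕ) : BipartiteGraph (Fin t) where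
  graph := pathGraph t
  side := pathGraph.bicoloring t

/-- The half-graph `H_k` of order `k`: vertices `a_i = inl i` and `b_j = inr j`, with `a_i`
adjacent to `b_j` iff `i ≤ j`, and bipartition `{a_i}`, `{b_j}`. -/
def halfGraph (k : ℕ) : BipartiteGraph (Fin k ⊕ Fin k) where
  graph :=
    { Adj := fun x y => match x, y with
        | .inl i, .inr j => i ≤ j
        | .inr j, .inl i => i ≤ j
        | _, _ => False
      symm := ⟨fun x y h => by cases x <;> cases y <;> exact h⟩
      loopless := ⟨fun x h => by cases x <;> exact h⟩ }
  side := Coloring.mk Sum.isLeft (fun {x y} h => by cases x <;> cases y <;> simp_all)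

end BipartiteGraph

open Classical in
/-- The bipartite graph `G[A, B]` semi-induced by disjoint vertex sets `A` and `B`: its vertex set is
`A ∪ B`, its sides are `A` and `B`, and its edges are the edges of `G` between `A` and `B`. -/
noncomputable def semiInduced {V : Type u} (G : SimpleGraph V) (A B : Set V)
    (hAB : Disjoint A B) : BipartiteGraph (A ∪ B : Set V) where
  graph := (G.between A B).induce (A ∪ B)
  side := Coloring.mk (fun x => decide (x.1 ∈ A)) (fun {x y} h => by
    have hd := Set.disjoint_left.mp hAB
    obtain ⟨-, h | h⟩ := h
    · have := fun hy => hd hy h.2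
      simp_all
    · have := fun hx => hd hx h.1
      simp_all)

/-- `G` excludes the bipartite graph `H` as a semi-induced subgraph. -/
def ExcludesSemiInduced {V : Type u} {W : Type v} (G : SimpleGraph V) (H : BipartiteGraph W) :
    Prop :=
  ∀ (A B : Set V) (hAB : Disjoint A B), ¬ H.Isomorphic (semiInduced G A B hAB)

/-! ### Tree models, cographs, bi-cographs -/

/-- The leaves of a rooted tree: the maximal elements of the ancestor order. -/
abbrev Leaf (T : RootedTree.{u}) : Type u := {x : T // IsMax x}

/-- The height of a rooted tree: the maximum number of edges on a path that descends from the root.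
(`Order.height x` is the number of edges on the path from the root to `x`.) -/
noncomputable def treeHeight (T : RootedTree.{u}) : ℕ∞ := ⨆ x : T, Order.height x

/-- A tree model whose leaves are coloured with colours from `C`. The order on the tree is the
ancestor order, so `x ⊓ y` is the least common ancestor of `x` and `y`. The table `f` is meant for
internal nodes; its values at leaves are never used. -/
structure TreeModel (C : Type v) where
  tree : RootedTree.{u}
  color : Leaf tree → C
  f : tree → C → C → Bool
  f_symm : ∀ x c d, f x c d = f x d c

/-- The graph on the leaves defined by a tree model. -/
def TreeModel.graph {C : Type v} (M : TreeModel.{u, v} C) : SimpleGraph (Leaf M.tree) where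
  Adj x y := x ≠ y ∧ M.f (x.1 ⊓ y.1) (M.color x) (M.color y) = true
  symm := ⟨fun x y h => ⟨h.1.symm, by rw [inf_comm, M.f_symm]; exact h.2⟩⟩
  loopless := ⟨fun _ h => h.1 rfl⟩

/-- `G` is a cograph of height at most `h`: it is defined by a tree model with one colour and
height at most `h` (a cotree). -/
def IsCograph {V : Type u} (G : SimpleGraph V) (h : ℕ) : Prop :=
  ∃ M : TreeModel.{u, 0} Unit, treeHeight M.tree ≤ (h : ℕ∞) ∧ Nonempty (M.graph ≃g G)

/-- `H` is a bi-cograph of height at most `h`: it is defined by a tree model with two colours and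
height at most `h` (a bi-cotree), whose leaf colouring is the bipartition of `H`. -/
def IsBiCograph {V : Type u} (H : BipartiteGraph V) (h : ℕ) : Prop :=
  ∃ M : TreeModel.{u, 0} Bool, treeHeight M.tree ≤ (h : ℕ∞) ∧
    ∃ φ : M.graph ≃g H.graph, ∀ x, H.side (φ x) = M.color x

/-! ### Cosplits -/

/-- `P` is a cosplit of `G` of height at most `h`: a partition of the vertex set into nonempty parts,
each of which induces a cograph of height at most `h`. -/
structure IsCosplit {V : Type u} (G : SimpleGraph V) (P : Set (Set V)) (h : ℕ) : Prop where
  isPartition : Setoid.IsPartition P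
  isCograph : ∀ A ∈ P, IsCograph (G.induce A) h

/-- `P` is a 2-cosplit of `G` of height at most `h`: moreover, every two distinct parts semi-induce a
bi-cograph of height at most `h`. -/
structure IsTwoCosplit {V : Type u} (G : SimpleGraph V) (P : Set (Set V)) (h : ℕ) : Prop
    extends IsCosplit G P h where
  isBiCograph : ∀ A ∈ P, ∀ B ∈ P, A ≠ B → ∀ hAB : Disjoint A B,
    IsBiCograph (semiInduced G A B hAB) h

end Cosplit

namespace Cosplit

open SimpleGraph

/-! Call a set decomposable if repeated cuts reduce it to single vertices, where the relevant pairs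
across each cut are all edges or all non-edges. The relevant pairs are all pairs (for cographs) or
the pairs from different sides (for bi-cographs); `bip` switches between the two, so one argument
serves both.

Height (`exists_treeModel`): take components of a decomposable set alternately in the edges and in
the non-edges. Every two levels yield a relevant pair whose first vertex is joined to all relevant
vertices further down, and whose second is joined to none. Sort these pairs by the side of the first
vertex. Among `2k` pairs some `k` agree and form `H_k`, so `4k` levels suffice.

Size (`hasPath_or_hasAlternation`): colour the vertices so that any choice of one class per side is
decomposable. If a bounded number of colours is not enough, a Gyárfás path argument gives either a
long induced path in the edges or non-edges, hence `P_t` or its bipartite complement, or a vertex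
that is homogeneous to a smaller set that still needs many colours. Iterating the second outcome
builds `H_k`.

The parts of the 2-cosplit are the classes of one colouring `c` for `bip = false`, refined by a
colouring for each bipartition "colour `i` against the rest". -/

/-! ### Rooted trees from chains of equivalence relations -/

/-- Pairs of a level at most `h` and a vertex; the pair `(i, x)` stands for the class of `x` under
the `i`-th equivalence relation. -/
structure LevelNode {U : Type u} (r : ℕ → Setoid U) (h : ℕ) : Type u where
  level : ℕ
  level_le : level ≤ h
  rep : U

namespace LevelNode

variable {U : Type u} {r : ℕ → Setoid U} {h : ℕ}

/-- The ancestor preorder on level nodes of an antitone chain. -/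
@[reducible] def preorder (hr : Antitone r) : Preorder (LevelNode r h) where
  le x y := x.level ≤ y.level ∧ r x.level x.rep y.rep
  le_refl x := ⟨le_rfl, (r _).refl _⟩
  le_trans x y z hxy hyz :=
    ⟨hxy.1.trans hyz.1, (r _).trans hxy.2 (hr hxy.1 hyz.2)⟩

end LevelNode

/-- The nodes are the pairs of a level and a class at that level, with a separate node even where a
class does not shrink. All leaves then lie at level `h`, and two leaves meet at the last level whose
relation contains both. -/
theorem exists_rootedTree_of_chain {U : Type u} [Nonempty U] (r : ℕ → Setoid U) (hr : Antitone r)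
    (h : ℕ) (h0 : r 0 = ⊤) (hh : r h = ⊥) :
    ∃ (T : RootedTree.{u}) (lev : T → ℕ) (e : U ≃ Leaf T), treeHeight T ≤ (h : ℕ∞) ∧
      ∀ x y, x ≠ y → r (lev ((e x).1 ⊓ (e y).1)) x y ∧ ¬ r (lev ((e x).1 ⊓ (e y).1) + 1) x y := by
  classical
  let : Preorder (LevelNode r h) := LevelNode.preorder hr
  have r_zero : ∀ x y, r 0 x y := fun x y => by rw [h0]; trivial
  have r_top : ∀ x y, r h x y → x = y := fun x y hxy => by rw [hh] at hxy; exact hxy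
  let α := Antisymmetrization (LevelNode r h) (· ≤ ·)
  let mk : LevelNode r h → α := toAntisymmetrization (· ≤ ·)
  have mk_le : ∀ a b, mk a ≤ mk b ↔ (a.level ≤ b.level ∧ r a.level a.rep b.rep) := fun a b =>
    toAntisymmetrization_le_toAntisymmetrization_iff
  have surj : ∀ p : α, ∃ a, mk a = p := fun p => ⟨ofAntisymmetrization _ p, by simp [mk]⟩
  let lev : α → ℕ := fun p => (ofAntisymmetrization (· ≤ ·) p).level
  have lev_mk : ∀ a, lev (mk a) = a.level := by
    intro a
    have h1 : mk (ofAntisymmetrization (· ≤ ·) (mk a)) = mk a := by simp [mk]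
    exact le_antisymm ((mk_le _ _).1 h1.le).1 ((mk_le _ _).1 h1.ge).1
  have lev_strict : StrictMono lev := by
    intro p q hpq
    obtain ⟨a, rfl⟩ := surj p
    obtain ⟨b, rfl⟩ := surj q
    rw [lev_mk, lev_mk]
    have h1 := (mk_le _ _).1 hpq.le
    refine lt_of_le_of_ne h1.1 fun h2 => hpq.not_ge ((mk_le _ _).2 ⟨h2.ge, ?_⟩)
    rw [← h2]
    exact (r _).symm h1.2
  have glb_mk : ∀ (i j : ℕ) (hi : i ≤ h) (hj : j ≤ h) (x y : U),
      IsGLB {mk ⟨i, hi, x⟩, mk ⟨j, hj, y⟩}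
        (mk ⟨Nat.findGreatest (fun m => r m x y) (min i j),
          (Nat.findGreatest_le _).trans ((min_le_left _ _).trans hi), x⟩) := by
    intro i j hi hj x y
    have hspec : r (Nat.findGreatest (fun m => r m x y) (min i j)) x y :=
      Nat.findGreatest_spec (P := fun m => r m x y) (Nat.zero_le _) (r_zero _ _)
    have hle := Nat.findGreatest_le (P := fun m => r m x y) (min i j)
    constructor
    · rintro p (rfl | rfl)
      · exact (mk_le _ _).2 ⟨hle.trans (min_le_left _ _), (r _).refl _⟩
      · exact (mk_le _ _).2 ⟨hle.trans (min_le_right _ _), hspec⟩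
    · intro p hp
      obtain ⟨a, rfl⟩ := surj p
      have h1 := (mk_le _ _).1 (hp (Set.mem_insert _ _))
      have h2 := (mk_le _ _).1 (hp (Set.mem_insert_of_mem _ rfl))
      exact (mk_le _ _).2 ⟨Nat.le_findGreatest (le_min h1.1 h2.1)
        ((r _).trans ((r _).symm h1.2) h2.2), h1.2⟩
  have hglb : ∀ p q : α, ∃ z, IsGLB {p, q} z := by
    intro p q
    obtain ⟨⟨i, hi, x⟩, rfl⟩ := surj p
    obtain ⟨⟨j, hj, y⟩, rfl⟩ := surj q
    exact ⟨_, glb_mk i j hi hj x y⟩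
  choose inf hinf using hglb
  have hpred : ∀ p : α, ∃ q, q ≤ p ∧ (p ≤ q → IsMin p) ∧ ∀ c, c < p → c ≤ q := by
    intro p
    obtain ⟨⟨i, hi, x⟩, rfl⟩ := surj p
    -- Truncated subtraction makes the root its own predecessor.
    refine ⟨mk ⟨i - 1, (Nat.sub_le _ _).trans hi, x⟩,
      (mk_le _ _).2 ⟨Nat.sub_le _ _, (r _).refl _⟩, ?_, ?_⟩
    · intro h1 c _
      have h2 := ((mk_le _ _).1 h1).1
      have h3 : i = 0 := by simp only at h2; omega
      obtain ⟨a, rfl⟩ := surj c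
      subst h3
      exact (mk_le _ _).2 ⟨Nat.zero_le _, r_zero _ _⟩
    · intro c hc
      have h1 := lev_strict hc
      obtain ⟨a, rfl⟩ := surj c
      rw [lev_mk, lev_mk] at h1
      simp only at h1
      exact (mk_le _ _).2 ⟨by simp only; omega, ((mk_le _ _).1 hc.le).2⟩
  choose pred hpred using hpred
  let semi : SemilatticeInf α :=
    { (inferInstance : PartialOrder α) with
      inf := inf
      inf_le_left := fun p q => (hinf p q).1 (Set.mem_insert _ _)
      inf_le_right := fun p q => (hinf p q).1 (Set.mem_insert_of_mem _ rfl)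
      le_inf := fun p q s h1 h2 => (hinf q s).2 (by rintro _ (rfl | rfl) <;> assumption) }
  let ob : OrderBot α :=
    { bot := mk ⟨0, Nat.zero_le _, Classical.arbitrary U⟩
      bot_le := fun p => by
        obtain ⟨a, rfl⟩ := surj p
        exact (mk_le _ _).2 ⟨Nat.zero_le _, r_zero _ _⟩ }
  let po : PredOrder α :=
    { pred := pred
      pred_le := fun p => (hpred p).1
      min_of_le_pred := fun {p} => (hpred p).2.1
      le_pred_of_lt := fun {c p} => (hpred p).2.2 c }
  have pa : IsPredArchimedean α := by
    constructor
    intro a b hab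
    induction hn : lev b using Nat.strong_induction_on generalizing b with
    | _ n ih =>
      rcases hab.eq_or_lt with rfl | hlt
      · exact ⟨0, rfl⟩
      · have h2 : Order.pred b < b :=
          Order.pred_lt_of_not_isMin fun hm => hlt.not_ge (hm hlt.le)
        obtain ⟨n, hn⟩ := ih _ (hn ▸ lev_strict h2) (Order.le_pred_of_lt hlt) rfl
        exact ⟨n + 1, hn⟩
  let T : RootedTree.{u} := ⟨α⟩
  have leaf_max : ∀ x, IsMax (mk ⟨h, le_rfl, x⟩) := by
    intro x c hc
    obtain ⟨a, rfl⟩ := surj c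
    have h1 := (mk_le _ _).1 hc
    refine (mk_le _ _).2 ⟨a.level_le, ?_⟩
    rw [le_antisymm a.level_le h1.1]
    exact (r _).symm h1.2
  let e : U ≃ Leaf T := Equiv.ofBijective (fun x => ⟨mk ⟨h, le_rfl, x⟩, leaf_max x⟩) (by
    constructor
    · intro x y hxy
      exact r_top _ _ ((mk_le _ _).1 (congrArg Subtype.val hxy).le).2
    · rintro ⟨p, hp⟩
      obtain ⟨⟨i, hi, x⟩, rfl⟩ := surj p
      have h1 : mk ⟨i, hi, x⟩ ≤ mk ⟨h, le_rfl, x⟩ := (mk_le _ _).2 ⟨hi, (r _).refl _⟩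
      exact ⟨x, Subtype.ext (le_antisymm (hp h1) h1)⟩)
  refine ⟨T, lev, e, ?_, ?_⟩
  · refine iSup_le fun p => ?_
    refine (Order.height_le_height_apply_of_strictMono lev lev_strict p).trans ?_
    rw [Order.height_nat]
    exact_mod_cast (ofAntisymmetrization (· ≤ ·) p).level_le
  · intro x y hxy
    have h1 : lev ((e x).1 ⊓ (e y).1) = Nat.findGreatest (fun m => r m x y) h := by
      have h2 := (hinf _ _).unique (glb_mk h h le_rfl le_rfl x y)
      refine (congrArg lev h2).trans ((lev_mk _).trans ?_)
      exact congrArg _ (min_self h)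
    rw [h1]
    have hspec : r (Nat.findGreatest (fun m => r m x y) h) x y :=
      Nat.findGreatest_spec (P := fun m => r m x y) (Nat.zero_le _) (r_zero _ _)
    refine ⟨hspec, fun h2 => ?_⟩
    have h3 := Nat.findGreatest_le (P := fun m => r m x y) h
    by_cases h4 : Nat.findGreatest (fun m => r m x y) h + 1 ≤ h
    · have := Nat.le_findGreatest (P := fun m => r m x y) h4 h2
      omega
    · have h5 : Nat.findGreatest (fun m => r m x y) h = h := by omega
      rw [h5] at hspec
      exact hxy (r_top _ _ hspec)

/-! ### Layers: edges and non-edges between related vertices -/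

/-- The vertex pairs that matter are those whose sides are equal (if `bip` is `false`) or different
(if `bip` is `true`). The layer `true` consists of the edges of `G` among these pairs, and the layer
`false` of the non-edges. -/
def layer {V : Type u} (G : SimpleGraph V) (side : V → Bool) (bip b : Bool) : SimpleGraph V where
  Adj x y := x ≠ y ∧ side y = (side x ^^ bip) ∧ (G.Adj x y ↔ b = true)
  symm := ⟨fun x y h => ⟨h.1.symm, by rw [h.2.1]; simp, by rw [G.adj_comm]; exact h.2.2⟩⟩
  loopless := ⟨fun _ h => h.1 rfl⟩

/-- There is no edge of `H` between `Y` and `Z`. -/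
def Separated {V : Type u} (H : SimpleGraph V) (Y Z : Set V) : Prop :=
  ∀ y ∈ Y, ∀ z ∈ Z, ¬ H.Adj y z

theorem Separated.symm {V : Type u} {H : SimpleGraph V} {Y Z : Set V} (h : Separated H Y Z) :
    Separated H Z Y := fun z hz y hy hzy => h y hy z hz hzy.symm

theorem Separated.mono {V : Type u} {H : SimpleGraph V} {Y Z Y' Z' : Set V} (h : Separated H Y Z)
    (hY : Y' ⊆ Y) (hZ : Z' ⊆ Z) : Separated H Y' Z' :=
  fun y hy z hz => h y (hY hy) z (hZ hz)

/-- Connectedness of the subgraph induced by `X`, in terms of cuts. -/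
def CutConnected {V : Type u} (H : SimpleGraph V) (X : Set V) : Prop :=
  ∀ Y Z : Set V, Y.Nonempty → Z.Nonempty → Disjoint Y Z → Y ∪ Z = X → ¬ Separated H Y Z

/-- Sets that can be built from subsingletons by unions without edges in one of the layers. -/
inductive Decomposable {V : Type u} (L : Bool → SimpleGraph V) : Set V → Prop
  | subsingleton {X : Set V} : X.Subsingleton → Decomposable L X
  | union {b : Bool} {Y Z : Set V} : Decomposable L Y → Decomposable L Z →
      Separated (L b) Y Z → Decomposable L (Y ∪ Z)

namespace Decomposable

variable {V : Type u} {L : Bool → SimpleGraph V} {X : Set V}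

theorem subset (h : Decomposable L X) {W : Set V} (hW : W ⊆ X) : Decomposable L W := by
  induction h generalizing W with
  | subsingleton h => exact .subsingleton (h.anti hW)
  | @union b Y Z _ _ hs ihY ihZ =>
    have h1 : W = (W ∩ Y) ∪ (W ∩ Z) := by
      rw [← Set.inter_union_distrib_left, Set.inter_eq_left.2 hW]
    rw [h1]
    exact .union (ihY Set.inter_subset_right) (ihZ Set.inter_subset_right)
      (hs.mono Set.inter_subset_right Set.inter_subset_right)

theorem mono_layers (h : Decomposable L X) {L' : Bool → SimpleGraph V}
    (hL : ∀ b, ∀ x ∈ X, ∀ y ∈ X, (L' b).Adj x y → (L b).Adj x y) : Decomposable L' X := by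
  induction h with
  | subsingleton h => exact .subsingleton h
  | @union b Y Z _ _ hs ihY ihZ =>
    exact .union (ihY fun b x hx y hy => hL b x (.inl hx) y (.inl hy))
      (ihZ fun b x hx y hy => hL b x (.inr hx) y (.inr hy))
      (fun y hy z hz hyz => hs y hy z hz (hL b y (.inl hy) z (.inr hz) hyz))

theorem preimage (h : Decomposable L X) {U : Type v} {f : U → V} (hf : Function.Injective f) :
    Decomposable (fun b => (L b).comap f) (f ⁻¹' X) := by
  induction h with
  | subsingleton h => exact .subsingleton (h.preimage hf)
  | @union b Y Z _ _ hs ihY ihZ =>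
    exact .union (b := b) ihY ihZ fun y hy z hz => hs _ hy _ hz

theorem exists_cut (h : Decomposable L X) {W : Set V} (hW : W ⊆ X) (hn : W.Nontrivial) :
    ∃ b Y Z, Set.Nonempty Y ∧ Set.Nonempty Z ∧ Disjoint Y Z ∧ Y ∪ Z = W ∧ Separated (L b) Y Z := by
  induction h generalizing W with
  | subsingleton h => exact absurd (h.anti hW) hn.not_subsingleton
  | @union b Y Z _ _ hs ihY ihZ =>
    by_cases h1 : W ⊆ Y
    · exact ihY h1 hn
    by_cases h2 : (W ∩ Y).Nonempty
    · refine ⟨b, W ∩ Y, W \ Y, h2, Set.sdiff_nonempty.2 h1, Set.disjoint_sdiff_inter.symm,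
        Set.inter_union_sdiff _ _, hs.mono Set.inter_subset_right fun x hx => ?_⟩
      exact (hW hx.1).resolve_left hx.2
    · refine ihZ (fun x hx => (hW hx).resolve_left fun hy => h2 ⟨x, hx, hy⟩) hn

theorem of_separated [Finite V] {b : Bool} (h : Separated (L b) X X) : Decomposable L X := by
  induction X, X.toFinite using Set.Finite.induction_on with
  | empty => exact .subsingleton Set.subsingleton_empty
  | @insert a S _ _ ih =>
    rw [Set.insert_eq]
    exact .union (.subsingleton Set.subsingleton_singleton)
      (ih (h.mono (Set.subset_insert _ _) (Set.subset_insert _ _)))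
      (h.mono (Set.singleton_subset_iff.2 (Set.mem_insert _ _)) (Set.subset_insert _ _))

end Decomposable

/-! ### Iterated components -/

/-- The equivalence relations obtained by alternately taking components in the layers `true` and
`false`, starting from the relation with one class. -/
def levelSetoid {U : Type u} (L : Bool → SimpleGraph U) : ℕ → Setoid U
  | 0 => ⊤
  | m + 1 => reachableSetoid
      { Adj := fun x y => (L (!m.bodd)).Adj x y ∧ levelSetoid L m x y
        symm := ⟨fun _ _ h => ⟨h.1.symm, (levelSetoid L m).symm h.2⟩⟩
        loopless := ⟨fun _ h => h.1.ne rfl⟩ }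

section Levels

variable {U : Type u} {L : Bool → SimpleGraph U}

theorem levelSetoid_succ_iff {m : ℕ} {x y : U} : levelSetoid L (m + 1) x y ↔
    Relation.ReflTransGen (fun x y => (L (!m.bodd)).Adj x y ∧ levelSetoid L m x y) x y :=
  reachable_iff_reflTransGen _ _

theorem levelSetoid_antitone : Antitone (levelSetoid L) := by
  refine antitone_nat_of_succ_le fun m x y h => ?_
  rw [levelSetoid_succ_iff] at h
  induction h with
  | refl => exact (levelSetoid L m).refl _
  | tail _ h ih => exact (levelSetoid L m).trans ih h.2

theorem levelSetoid_succ_of_adj {m : ℕ} {x y : U} (h : levelSetoid L m x y)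
    (hxy : (L (!m.bodd)).Adj x y) : levelSetoid L (m + 1) x y :=
  levelSetoid_succ_iff.2 (.single ⟨hxy, h⟩)

/-- A walk that witnesses the relation stays inside the class, so it crosses every cut of the class.
-/
theorem cutConnected_levelSetoid_succ (m : ℕ) (a : U) :
    CutConnected (L (!m.bodd)) {x | levelSetoid L (m + 1) a x} := by
  rintro Y Z ⟨y, hy⟩ ⟨z, hz⟩ hd hYZ hs
  have hY : levelSetoid L (m + 1) a y := hYZ.subset (.inl hy)
  have hZ : levelSetoid L (m + 1) a z := hYZ.subset (.inr hz)
  have hyz : levelSetoid L (m + 1) y z := (levelSetoid L (m + 1)).trans ((levelSetoid L (m + 1)).symm hY) hZ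
  rw [levelSetoid_succ_iff] at hyz
  refine Set.disjoint_left.1 hd ?_ hz
  clear hZ hz
  induction hyz with
  | refl => exact hy
  | @tail c d _ hcd ih =>
    have hc : levelSetoid L (m + 1) a c := hYZ.subset (.inl ih)
    have hdm : d ∈ Y ∪ Z := hYZ.superset
      ((levelSetoid L (m + 1)).trans hc (levelSetoid_succ_of_adj hcd.2 hcd.1))
    exact hdm.resolve_right fun hz => hs c ih d hz hcd.1

/-- The class at level `m + 1` is connected in the layer just used, so the cut provided by
decomposability is in the other layer, which is the one that defines level `m + 2`. -/
theorem exists_not_levelSetoid_succ (hL : Decomposable L Set.univ) {m : ℕ} {a c : U} (hac : a ≠ c)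
    (h : levelSetoid L (m + 1) a c) :
    ∃ x, levelSetoid L (m + 1) a x ∧ ¬ levelSetoid L (m + 2) a x := by
  obtain ⟨b, Y, Z, hY, hZ, hd, hYZ, hs⟩ := hL.exists_cut (W := {x | levelSetoid L (m + 1) a x})
    (Set.subset_univ _) ⟨a, (levelSetoid L (m + 1)).refl a, c, h, hac⟩
  have hb : b = !(m + 1).bodd := by
    by_contra hb
    have hb : b = !m.bodd := by
      rw [Nat.bodd_succ] at hb
      cases b <;> cases h : m.bodd <;> simp_all
    exact cutConnected_levelSetoid_succ m a Y Z hY hZ hd hYZ (hb ▸ hs)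
  by_contra! hall
  have heq : {x | levelSetoid L (m + 1) a x} = {x | levelSetoid L (m + 2) a x} :=
    Set.Subset.antisymm hall fun x hx => levelSetoid_antitone (Nat.le_succ _) hx
  exact cutConnected_levelSetoid_succ (m + 1) a Y Z hY hZ hd (hYZ.trans heq) (hb ▸ hs)

end Levels

/-! ### Alternating sequences -/

/-- `C` contains a sequence of `n` vertices that alternate between the side `s` and its related
side, where each is related to the later ones alternately by the layers `b` and `!b`. -/
def HasAlternation {V : Type u} (L : Bool → SimpleGraph V) (side : V → Bool) (bip : Bool) :
    ℕ → Bool → Bool → Set V → Prop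
  | 0, _, _, _ => True
  | n + 1, s, b, C => ∃ x ∈ C, side x = s ∧ ∃ D ⊆ C, x ∉ D ∧ (∀ z ∈ D, ¬ (L (!b)).Adj x z) ∧
      HasAlternation L side bip n (s ^^ bip) (!b) D

theorem HasAlternation.mono {V : Type u} {L : Bool → SimpleGraph V} {side : V → Bool} {bip : Bool}
    {n : ℕ} {s b : Bool} {C C' : Set V} (h : HasAlternation L side bip n s b C) (hC : C ⊆ C') :
    HasAlternation L side bip n s b C' := by
  cases n with
  | zero => trivial
  | succ n =>
    obtain ⟨x, hx, hs, D, hD, h⟩ := h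
    exact ⟨x, hC hx, hs, D, hD.trans hC, h⟩

theorem HasAlternation.exists_seq {V : Type u} {L : Bool → SimpleGraph V} {side : V → Bool}
    {bip : Bool} {n : ℕ} {s b : Bool} {C : Set V} [Nonempty V]
    (h : HasAlternation L side bip n s b C) :
    ∃ q : ℕ → V, (∀ i < n, q i ∈ C ∧ side (q i) = (s ^^ (i.bodd && bip))) ∧
      ∀ i j, i < j → j < n → q i ≠ q j ∧ ¬ (L (!(b ^^ i.bodd))).Adj (q i) (q j) := by
  induction n generalizing s b C with
  | zero => exact ⟨fun _ => Classical.arbitrary V, by simp, by simp⟩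
  | succ n ih =>
    obtain ⟨x, hx, hs, D, hD, hxD, hL, h⟩ := h
    obtain ⟨q, hq, hq'⟩ := ih h
    refine ⟨fun i => Nat.casesOn i x q, ?_, ?_⟩
    · rintro (_ | i) hi
      · simp [hx, hs]
      · refine ⟨hD (hq i (by omega)).1, ?_⟩
        simp only [(hq i (by omega)).2, Nat.bodd_succ]
        cases s <;> cases bip <;> cases i.bodd <;> rfl
    · rintro (_ | i) (_ | j) hij hj
      · omega
      · have := hq j (by omega)
        exact ⟨fun h : x = q j => hxD (h ▸ this.1), by simpa using hL _ this.1⟩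
      · omega
      · have := hq' i j (by omega) (by omega)
        refine ⟨this.1, ?_⟩
        simpa using this.2

section LevelAlternation

variable {U : Type u} {L : Bool → SimpleGraph U} {side : U → Bool} {bip : Bool}

/-- Vertices `x` and `y` that drop out of the class of `a` at consecutive levels may be unrelated.
By connectedness, `y` has a neighbour `z` in layer `true` within the larger class. Either `z` drops
out early and replaces `x`, or it drops out together with `y` and, being on the related side, can
replace `y`. -/
theorem exists_related_pair (hR : ∀ b x y, (L b).Adj x y → side y = (side x ^^ bip))
    (hside : ∀ x y, side x = side y ∨ side x = (side y ^^ bip))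
    (hL : Decomposable L Set.univ) {m : ℕ} (hm : m.bodd = false) {a c : U} (hac : a ≠ c)
    (h : levelSetoid L (m + 2) a c) :
    ∃ x y, levelSetoid L (m + 1) a x ∧ ¬ levelSetoid L (m + 2) a x ∧ levelSetoid L (m + 2) a y ∧
      ¬ levelSetoid L (m + 3) a y ∧ side y = (side x ^^ bip) := by
  obtain ⟨x, hx, hx'⟩ := exists_not_levelSetoid_succ hL hac (levelSetoid_antitone (Nat.le_succ _) h)
  obtain ⟨y, hy, hy'⟩ := exists_not_levelSetoid_succ hL hac h
  have hy1 : levelSetoid L (m + 1) a y := levelSetoid_antitone (Nat.le_succ _) hy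
  have hxy : x ≠ y := fun e => hx' (e ▸ hy)
  obtain ⟨z, hz, hyz⟩ : ∃ z, levelSetoid L (m + 1) a z ∧ (L true).Adj y z := by
    by_contra! hno
    refine cutConnected_levelSetoid_succ (L := L) m a {y} ({x | levelSetoid L (m + 1) a x} \ {y})
      (Set.singleton_nonempty y) ⟨x, hx, hxy⟩ Set.disjoint_sdiff_right ?_ ?_
    · exact Set.union_sdiff_cancel (Set.singleton_subset_iff.2 hy1)
    · rintro _ rfl z hz
      rw [hm]
      exact hno z hz.1
  by_cases hz2 : levelSetoid L (m + 2) a z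
  · have hyz2 : levelSetoid L (m + 3) y z := by
      refine levelSetoid_succ_of_adj ((levelSetoid L _).trans ((levelSetoid L _).symm hy) hz2) ?_
      simpa [Nat.bodd_succ, hm] using hyz
    have hz3 : ¬ levelSetoid L (m + 3) a z := fun hz3 =>
      hy' ((levelSetoid L _).trans hz3 ((levelSetoid L _).symm hyz2))
    have hs := hR _ _ _ hyz
    rcases hside x y with h1 | h1
    · exact ⟨x, z, hx, hx', hz2, hz3, by rw [h1, hs]⟩
    · exact ⟨x, y, hx, hx', hy, hy', by rw [h1]; simp⟩
  · exact ⟨z, y, hz, hz2, hy, hy', hR _ _ _ hyz.symm⟩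

/-- Pigeonhole on the side of the first vertex: each step descends two levels and prepends a pair to
one of the two alternations, whose remaining numbers of pairs are `i` and `j`. -/
theorem hasAlternation_of_levelSetoid (hR : ∀ b x y, (L b).Adj x y → side y = (side x ^^ bip))
    {s : Bool} (hs : ∀ x, side x = s ∨ side x = (s ^^ bip)) (hL : Decomposable L Set.univ)
    {h : ℕ} {a c : U} (hac : a ≠ c) (hr : levelSetoid L h a c) (i j m : ℕ)
    (hm : m.bodd = false) (hmh : m + 2 * (i + j) ≤ h) :
    HasAlternation L side bip (2 * i) s true {x | levelSetoid L (m + 1) a x} ∨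
    HasAlternation L side bip (2 * j) (s ^^ bip) true {x | levelSetoid L (m + 1) a x} := by
  induction hn : i + j generalizing i j m with
  | zero =>
    obtain rfl : i = 0 := by omega
    exact .inl trivial
  | succ n ih =>
    rcases i with _ | i
    · exact .inl trivial
    rcases j with _ | j
    · exact .inr trivial
    have hside : ∀ x y, side x = side y ∨ side x = (side y ^^ bip) := by
      intro x y
      rcases hs x with h1 | h1 <;> rcases hs y with h2 | h2 <;> simp [h1, h2]
    obtain ⟨x, y, hx, hx', hy, hy', hxy⟩ := exists_related_pair hR hside hL hm hac
      (levelSetoid_antitone (by omega : m + 2 ≤ h) hr)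
    -- Since `x` lies outside the component of `a` in layer `false`, it is joined to all related
    -- vertices of that component; dually for `y` and layer `true` one level below.
    have key : ∀ l σ, side x = σ →
        HasAlternation L side bip (2 * l) σ true {x | levelSetoid L (m + 3) a x} →
        HasAlternation L side bip (2 * (l + 1)) σ true {x | levelSetoid L (m + 1) a x} := by
      intro l σ hσ hl
      refine ⟨x, hx, hσ, {x | levelSetoid L (m + 2) a x},
        fun z hz => levelSetoid_antitone (Nat.le_succ _) hz, hx', ?_,
        y, hy, by rw [hxy, hσ], {x | levelSetoid L (m + 3) a x},
        fun z hz => levelSetoid_antitone (Nat.le_succ _) hz, hy', ?_, by simpa using hl⟩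
      · intro z hz hxz
        have hz1 : levelSetoid L (m + 1) a z := levelSetoid_antitone (Nat.le_succ _) hz
        have h1 : levelSetoid L (m + 2) x z := levelSetoid_succ_of_adj
          ((levelSetoid L _).trans ((levelSetoid L _).symm hx) hz1)
          (by simpa [Nat.bodd_succ, hm] using hxz)
        exact hx' ((levelSetoid L _).trans hz ((levelSetoid L _).symm h1))
      · intro z hz hyz
        have hz1 : levelSetoid L (m + 2) a z := levelSetoid_antitone (Nat.le_succ _) hz
        have h1 : levelSetoid L (m + 3) y z := levelSetoid_succ_of_adj
          ((levelSetoid L _).trans ((levelSetoid L _).symm hy) hz1)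
          (by simpa [Nat.bodd_succ, hm] using hyz)
        exact hy' ((levelSetoid L _).trans hz ((levelSetoid L _).symm h1))
    have hsub : {x | levelSetoid L (m + 3) a x} ⊆ {x | levelSetoid L (m + 1) a x} :=
      fun z hz => levelSetoid_antitone (by omega : m + 1 ≤ m + 3) hz
    have hm2 : (m + 2).bodd = false := by simpa [Nat.bodd_succ] using hm
    rcases hs x with h1 | h1
    · rcases ih i (j + 1) (m + 2) hm2 (by omega) (by omega) with h2 | h2
      · exact .inl (key i _ h1 h2)
      · exact .inr (h2.mono hsub)
    · rcases ih (i + 1) j (m + 2) hm2 (by omega) (by omega) with h2 | h2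
      · exact .inl (h2.mono hsub)
      · exact .inr (key j _ h1 h2)

end LevelAlternation

/-! ### Tree models of bounded height -/

/-- A decomposable graph without long alternations has a tree model of bounded height. -/
theorem exists_treeModel {U : Type u} [Nonempty U] (G : SimpleGraph U) (side : U → Bool)
    (bip : Bool) (hd : Decomposable (layer G side bip) Set.univ) {s : Bool}
    (hs : ∀ x, side x = s ∨ side x = (s ^^ bip)) (k : ℕ)
    (h1 : ¬ HasAlternation (layer G side bip) side bip (2 * k) s true Set.univ)
    (h2 : ¬ HasAlternation (layer G side bip) side bip (2 * k) (s ^^ bip) true Set.univ)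
    {C : Type v} (color : U → C) (rel : C → C → Bool) (rel_symm : ∀ c d, rel c d = rel d c)
    (hrel : ∀ x y, rel (color x) (color y) = true ↔ side y = (side x ^^ bip)) :
    ∃ M : TreeModel.{u, v} C, treeHeight M.tree ≤ ((4 * k : ℕ) : ℕ∞) ∧ ∃ e : U ≃ Leaf M.tree,
      (∀ x, M.color (e x) = color x) ∧
      ∀ x y, M.graph.Adj (e x) (e y) ↔ side y = (side x ^^ bip) ∧ G.Adj x y := by
  have hbot : levelSetoid (layer G side bip) (4 * k) = ⊥ := by
    refine le_bot_iff.1 fun a c hac => ?_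
    by_contra hne
    rcases hasAlternation_of_levelSetoid (L := layer G side bip) (fun b x y h => h.2.1) hs hd hne hac k k 0 rfl
      (by omega) with h | h
    · exact h1 (h.mono (Set.subset_univ _))
    · exact h2 (h.mono (Set.subset_univ _))
  obtain ⟨T, lev, e, hT, he⟩ := exists_rootedTree_of_chain _ levelSetoid_antitone (4 * k) rfl hbot
  -- Two related vertices that separate right after level `m` are not in the layer `!m.bodd`, so
  -- they are adjacent exactly when `m` is odd.
  refine ⟨⟨T, fun l => color (e.symm l), fun x c d => rel c d && (lev x).bodd,
    fun x c d => by rw [rel_symm]⟩, hT, e, fun x => by simp, fun x y => ?_⟩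
  by_cases hxy : x = y
  · subst hxy
    simp
  have hadj := (he x y hxy)
  set m := lev ((e x).1 ⊓ (e y).1) with hm
  have hnot : ¬ (layer G side bip (!m.bodd)).Adj x y := fun h =>
    hadj.2 (levelSetoid_succ_of_adj hadj.1 h)
  change (e x ≠ e y ∧ (rel (color (e.symm (e x))) (color (e.symm (e y))) && m.bodd) = true) ↔ _
  rw [Equiv.symm_apply_apply, Equiv.symm_apply_apply, Bool.and_eq_true, hrel]
  simp only [ne_eq, EmbeddingLike.apply_eq_iff_eq, hxy, not_false_eq_true, true_and]
  refine and_congr_right fun hR => ?_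
  have h3 : ¬ (G.Adj x y ↔ (!m.bodd) = true) := fun h => hnot ⟨hxy, hR, h⟩
  cases hb : m.bodd <;> simp_all

/-! ### Colourings with decomposable classes -/

/-- The colours available after `m` splitting steps. -/
def SplitColor : ℕ → Type
  | 0 => Unit
  | m + 1 => SplitColor m × SplitColor m × Bool

theorem SplitColor.finite : ∀ m, Finite (SplitColor m)
  | 0 => inferInstanceAs (Finite Unit)
  | m + 1 => by
    have := SplitColor.finite m
    exact inferInstanceAs (Finite (SplitColor m × SplitColor m × Bool))

theorem SplitColor.nonempty : ∀ m, Nonempty (SplitColor m)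
  | 0 => inferInstanceAs (Nonempty Unit)
  | m + 1 => by
    have := SplitColor.nonempty m
    exact inferInstanceAs (Nonempty (SplitColor m × SplitColor m × Bool))

/-- `X` has a colouring by `SplitColor m` such that any choice of one colour class on each side
yields a decomposable set. -/
def SplitColorable {V : Type u} (G : SimpleGraph V) (side : V → Bool) (bip : Bool) (m : ℕ)
    (X : Set V) : Prop :=
  ∃ c : V → SplitColor m, ∀ g : Bool → SplitColor m,
    Decomposable (layer G side bip) {x ∈ X | c x = g (side x)}

namespace SplitColorable

variable {V : Type u} {G : SimpleGraph V} {side : V → Bool} {bip : Bool} {m : ℕ} {X Y Z : Set V}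

theorem subset (h : SplitColorable G side bip m X) (hY : Y ⊆ X) :
    SplitColorable G side bip m Y := by
  obtain ⟨c, hc⟩ := h
  exact ⟨c, fun g => (hc g).subset fun x hx => ⟨hY hx.1, hx.2⟩⟩

theorem of_decomposable (h : Decomposable (layer G side bip) X) :
    SplitColorable G side bip m X := by
  have := SplitColor.nonempty m
  exact ⟨fun _ => Classical.arbitrary _, fun g => h.subset fun x hx => hx.1⟩

theorem succ (h : SplitColorable G side bip m X) : SplitColorable G side bip (m + 1) X := by
  obtain ⟨c, hc⟩ := h
  refine ⟨fun x => (c x, c x, true), fun g => (hc fun s => (g s).1).subset ?_⟩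
  exact fun x hx => ⟨hx.1, congrArg Prod.fst hx.2⟩

theorem mono (h : SplitColorable G side bip m X) {n : ℕ} (hmn : m ≤ n) :
    SplitColorable G side bip n X := by
  induction hmn with
  | refl => exact h
  | step _ ih => exact ih.succ

theorem union (hY : SplitColorable G side bip m Y) (hZ : SplitColorable G side bip m Z) {b : Bool}
    (hs : Separated (layer G side bip b) Y Z) : SplitColorable G side bip m (Y ∪ Z) := by
  classical
  obtain ⟨c, hc⟩ := hY
  obtain ⟨d, hd⟩ := hZ
  refine ⟨fun x => if x ∈ Y then c x else d x, fun g => ?_⟩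
  refine (Decomposable.union (hc g) (hd g)
    (hs.mono (fun x hx => hx.1) (fun x hx => hx.1))).subset ?_
  rintro x ⟨hx, hxg⟩
  by_cases h : x ∈ Y
  · exact .inl ⟨h, by simpa [h] using hxg⟩
  · exact .inr ⟨hx.resolve_left h, by simpa [h] using hxg⟩

/-- Splitting at the vertex `v`. -/
theorem of_split (v : V)
    (h : ∀ b, SplitColorable G side bip m {x ∈ X | ¬ (layer G side bip b).Adj v x}) :
    SplitColorable G side bip (m + 1) X := by
  classical
  obtain ⟨c, hc⟩ := h false
  obtain ⟨d, hd⟩ := h true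
  -- On the side related to `v`, the last bit makes a colour class homogeneous to `v`. Vertices of
  -- the other side lie in both sets of the split, so one of the two colourings applies to the whole
  -- choice.
  refine ⟨fun x => (c x, d x, decide ((layer G side bip true).Adj v x)), fun g => ?_⟩
  rcases hb : (g (side v ^^ bip)).2.2 with _ | _
  · refine (hd fun s => (g s).2.1).subset ?_
    rintro x ⟨hx, hxg⟩
    refine ⟨⟨hx, fun hvx => ?_⟩, congrArg (fun p => p.2.1) hxg⟩
    have h1 := congrArg (fun p => p.2.2) hxg
    simp only [hvx.2.1, hb, hvx, decide_true] at h1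
    exact absurd h1 (by simp)
  · refine (hc fun s => (g s).1).subset ?_
    rintro x ⟨hx, hxg⟩
    refine ⟨⟨hx, fun hvx => ?_⟩, congrArg (fun p => p.1) hxg⟩
    have h1 := congrArg (fun p => p.2.2) hxg
    simp only [hvx.2.1, hb, decide_eq_true_eq] at h1
    have h2 := hvx.2.2
    have h3 := h1.2.2
    simp_all

theorem insert_of_separated (h : SplitColorable G side bip m X) {v : V} {b : Bool}
    (hs : ∀ x ∈ X, ¬ (layer G side bip b).Adj v x) : SplitColorable G side bip m (insert v X) := by
  rw [Set.insert_eq]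
  refine union (of_decomposable (.subsingleton Set.subsingleton_singleton)) h (b := b) ?_
  rintro _ rfl x hx
  exact hs x hx

theorem insert (h : SplitColorable G side bip m X) (v : V) :
    SplitColorable G side bip (m + 1) (insert v X) := by
  refine of_split v fun b => ?_
  refine (insert_of_separated (X := {x ∈ X | ¬ (layer G side bip b).Adj v x}) (v := v) (b := b)
    (h.subset fun x hx => hx.1) fun x hx => hx.2).subset ?_
  rintro x ⟨hx | hx, hvx⟩
  · exact .inl hx
  · exact .inr ⟨hx, hvx⟩

end SplitColorable

/-- Contrapositive of `of_split`; `v` itself can be dropped because it is separated from what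
remains, so putting it back costs no colour. -/
theorem SplitColorable.exists_split {V : Type u} {G : SimpleGraph V} {side : V → Bool}
    {bip : Bool} {m : ℕ} {X : Set V}
    (h : ¬ SplitColorable G side bip (m + 1) X) (v : V) :
    ∃ b, ¬ SplitColorable G side bip m {x ∈ X | x ≠ v ∧ ¬ (layer G side bip b).Adj v x} := by
  by_contra! hall
  refine h (SplitColorable.of_split v fun b => ?_)
  refine ((hall b).insert_of_separated (v := v) (b := b) fun x hx => hx.2.2).subset ?_
  rintro x ⟨hx, hvx⟩
  by_cases hxv : x = v
  · exact .inl hxv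
  · exact .inr ⟨hx, hxv, hvx⟩

/-! ### Paths and alternations in uncolourable sets -/

/-- An induced path with `n` edges in `H` starts at `v` and continues in `D`. -/
def HasPath {V : Type u} (H : SimpleGraph V) : ℕ → V → Set V → Prop
  | 0, _, _ => True
  | n + 1, v, D => ∃ w ∈ D, H.Adj v w ∧ ∃ D' ⊆ D, w ∉ D' ∧ (∀ x ∈ D', ¬ H.Adj v x) ∧
      HasPath H n w D'

theorem HasPath.exists_seq {V : Type u} {H : SimpleGraph V} {n : ℕ} {v : V} {D : Set V} (hv : v ∉ D)
    (h : HasPath H n v D) :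
    ∃ p : ℕ → V, p 0 = v ∧ (∀ i < n, p (i + 1) ∈ D ∧ H.Adj (p i) (p (i + 1))) ∧
      ∀ i j, i < j → j ≤ n → p i ≠ p j ∧ (H.Adj (p i) (p j) → j = i + 1) := by
  induction n generalizing v D with
  | zero => exact ⟨fun _ => v, rfl, by simp, fun i j _ _ => by omega⟩
  | succ n ih =>
    obtain ⟨w, hw, hvw, D', hD', hwD', hsep, h⟩ := h
    obtain ⟨p, hp0, hp, hp'⟩ := ih hwD' h
    refine ⟨fun i => Nat.casesOn i v p, rfl, ?_, ?_⟩
    · rintro (_ | i) hi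
      · change p 0 ∈ D ∧ H.Adj v (p 0)
        exact hp0.symm ▸ ⟨hw, hvw⟩
      · exact ⟨hD' (hp i (by omega)).1, (hp i (by omega)).2⟩
    · rintro (_ | i) (_ | j) hij hj
      · omega
      · rcases j with _ | j
        · exact ⟨fun h : v = p 0 => hv (h ▸ hp0 ▸ hw), fun _ => rfl⟩
        · have hj := (hp j (by omega)).1
          exact ⟨fun h : v = p (j + 1) => hv (h ▸ hD' hj), fun h => absurd h (hsep _ hj)⟩
      · omega
      · have := hp' i j (by omega) (by omega)
        exact ⟨this.1, fun h => by rw [this.2 h]⟩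

section Extraction

variable {V : Type u} [Finite V] {G : SimpleGraph V} {side : V → Bool} {bip : Bool}

/-- A set that is not colourable contains a connected one, separated from its complement. -/
theorem SplitColorable.exists_component {m : ℕ} {X : Set V} (b : Bool)
    (h : ¬ SplitColorable G side bip m X) :
    ∃ D ⊆ X, ¬ SplitColorable G side bip m D ∧ CutConnected (layer G side bip b) D ∧
      Separated (layer G side bip b) D (X \ D) := by
  obtain ⟨D, hD⟩ := Set.Finite.exists_minimal (s := {D : Set V | D ⊆ X ∧
    ¬ SplitColorable G side bip m D ∧ Separated (layer G side bip b) D (X \ D)}) (Set.toFinite _)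
    ⟨X, subset_rfl, h, by simp [Separated]⟩
  obtain ⟨⟨hDX, hDm, hDs⟩, hmin⟩ := hD
  refine ⟨D, hDX, hDm, ?_, hDs⟩
  -- A proper part cut off from the rest of `D` is also separated from `X \ D`, so it is colourable
  -- by minimality.
  have key : ∀ Y Z : Set V, Z.Nonempty → Disjoint Y Z → Y ∪ Z = D →
      Separated (layer G side bip b) Y Z → SplitColorable G side bip m Y := by
    rintro Y Z ⟨z, hz⟩ hd rfl hs
    by_contra hY
    have h1 : Y ∪ Z ⊆ Y := hmin (y := Y) ⟨Set.subset_union_left.trans hDX, hY, ?_⟩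
      Set.subset_union_left
    · exact Set.disjoint_left.1 hd (h1 (.inr hz)) hz
    · intro y hy x hx
      by_cases hxZ : x ∈ Z
      · exact hs y hy x hxZ
      · exact hDs y (.inl hy) x ⟨hx.1, fun h => h.elim hx.2 hxZ⟩
  intro Y Z hY hZ hd hYZ hs
  refine hDm (hYZ ▸ (key Y Z hZ hd hYZ hs).union ?_ hs)
  exact key Z Y hY hd.symm (by rwa [Set.union_comm]) hs.symm

/-- Either there is a long induced path in the layer `b`, or a vertex that is completely joined in
the layer `b` to a set that is not colourable. -/
theorem hasPath_or_exists_joined (b : Bool) (m n : ℕ) (v : V) (D : Set V) (hv : v ∉ D)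
    (hc : CutConnected (layer G side bip b) (insert v D))
    (h : ¬ SplitColorable G side bip (m + n) D) :
    HasPath (layer G side bip b) n v D ∨ ∃ u ∈ insert v D, ∃ Z ⊆ D, u ∉ Z ∧
      ¬ SplitColorable G side bip m Z ∧ ∀ z ∈ Z, ¬ (layer G side bip (!b)).Adj u z := by
  induction n generalizing v D with
  | zero => exact .inl trivial
  | succ n ih =>
    obtain ⟨b', hb'⟩ := SplitColorable.exists_split h v
    -- Gyárfás path: if the non-neighbours of `v` are uncolourable, the path moves on to a vertex
    -- `w` attached to an uncolourable component `D'` of them. Otherwise `v` itself is the joined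
    -- vertex.
    by_cases hbb : b' = b
    · subst hbb
      obtain ⟨D', hD', hnc, hconn, hsep⟩ := SplitColorable.exists_component b' hb'
      have hD'D : D' ⊆ D := fun x hx => (hD' hx).1
      have hvD' : v ∉ D' := fun hx => hv (hD'D hx)
      have hne : D'.Nonempty := by
        by_contra hne
        rw [Set.not_nonempty_iff_eq_empty] at hne
        exact hnc (.of_decomposable (.subsingleton (hne ▸ Set.subsingleton_empty)))
      have hcut := hc (insert v D \ D') D' ⟨v, .inl rfl, hvD'⟩ hne Set.disjoint_sdiff_left
        (Set.sdiff_union_of_subset (hD'D.trans (Set.subset_insert _ _)))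
      unfold Separated at hcut
      push Not at hcut
      obtain ⟨w, ⟨hw, hwD'⟩, d, hd, hwd⟩ := hcut
      have hwv : w ≠ v := by
        rintro rfl
        exact (hD' hd).2.2 hwd
      have hwD : w ∈ D := hw.resolve_left hwv
      -- Otherwise `w` would be a non-neighbour of `v` adjacent to `D'`, hence in the component
      -- `D'`.
      have hvw : (layer G side bip b').Adj v w := by
        by_contra hvw
        exact hsep d hd w ⟨⟨hwD, hwv, hvw⟩, hwD'⟩ hwd.symm
      have hconn' : CutConnected (layer G side bip b') (insert w D') := by
        have key : ∀ Y Z : Set V, w ∈ Y → Z.Nonempty → Disjoint Y Z → Y ∪ Z = insert w D' →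
            ¬ Separated (layer G side bip b') Y Z := by
          intro Y Z hwY hZ hd' hYZ hs
          have hwZ : w ∉ Z := Set.disjoint_left.1 hd' hwY
          have hZD : Z ⊆ D' := fun z hz =>
            (hYZ.subset (.inr hz)).resolve_left fun h => hwZ (h ▸ hz)
          rcases (Y ∩ D').eq_empty_or_nonempty with hY | hY
          · have hdZ : d ∈ Z := (hYZ.superset (.inr hd)).resolve_left fun h =>
              Set.notMem_empty d (hY ▸ ⟨h, hd⟩)
            exact hs w hwY d hdZ hwd
          · refine hconn (Y ∩ D') Z hY hZ (hd'.mono_left Set.inter_subset_left) ?_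
              (hs.mono Set.inter_subset_left subset_rfl)
            have h1 : (Y ∪ Z) ∩ D' = D' := by
              rw [hYZ]
              exact Set.inter_eq_right.2 (Set.subset_insert _ _)
            rwa [Set.union_inter_distrib_right, Set.inter_eq_left.2 hZD] at h1
        intro Y Z hY hZ hd' hYZ hs
        rcases hYZ.superset (.inl rfl : w ∈ insert w D') with hwY | hwZ
        · exact key Y Z hwY hZ hd' hYZ hs
        · exact key Z Y hwZ hY hd'.symm (by rwa [Set.union_comm]) hs.symm
      rcases ih w D' hwD' hconn' hnc with h1 | ⟨u, hu, Z, hZ, h1⟩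
      · exact .inl ⟨w, hwD, hvw, D', hD'D, hwD', fun x hx => (hD' hx).2.2, h1⟩
      · refine .inr ⟨u, ?_, Z, hZ.trans hD'D, h1⟩
        rcases hu with rfl | hu
        · exact .inr hwD
        · exact .inr (hD'D hu)
    · refine .inr ⟨v, .inl rfl, {x ∈ D | x ≠ v ∧ ¬ (layer G side bip b').Adj v x},
        fun x hx => hx.1, fun hx => hx.2.1 rfl, ?_, fun z hz => ?_⟩
      · exact fun hZ => hb' (hZ.mono (n := m + n) (Nat.le_add_right m n))
      · have : b' = !b := by cases b <;> cases b' <;> simp_all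
        exact this ▸ hz.2.2

theorem SplitColorable.exists_mem_side {m : ℕ} {X : Set V}
    (h : ¬ SplitColorable G side bip m X) {s : Bool}
    (hs : ∀ x, side x = s ∨ side x = (s ^^ bip)) : ∃ x ∈ X, side x = s := by
  by_contra! hX
  refine h (.of_decomposable (.of_separated (b := true) fun x hx y hy hxy => hX y hy ?_))
  rw [hxy.2.1, (hs x).resolve_left (hX x hx)]
  simp

/-- A set that is not colourable contains a long induced path in one of the layers, or one of two
long alternations. -/
theorem hasPath_or_hasAlternation (t : ℕ) (n i j : ℕ) (hn : i + j = n) (X : Set V) (s s' b b' : Bool)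
    (hs : ∀ x, side x = s ∨ side x = (s ^^ bip))
    (hs' : s' = s ∧ b' = !b ∨ s' = (s ^^ bip) ∧ b' = b)
    (h : ¬ SplitColorable G side bip (n * (t + 1)) X) :
    (∃ b v D, v ∉ D ∧ HasPath (layer G side bip b) t v D) ∨
    HasAlternation (layer G side bip) side bip i s b X ∨
    HasAlternation (layer G side bip) side bip j s' b' X := by
  induction n generalizing i j X s s' b b' with
  | zero =>
    obtain rfl : i = 0 := by omega
    exact .inr (.inl trivial)
  | succ n ih =>
    rcases i with _ | i
    · exact .inr (.inl trivial)
    rcases j with _ | j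
    · exact .inr (.inr trivial)
    have hbip : ∀ x, side x = (s ^^ bip) ∨ side x = ((s ^^ bip) ^^ bip) := fun x => by
      simpa using (hs x).symm
    have fst_step : ∀ v ∈ X, side v = s → ∀ D ⊆ X, v ∉ D →
        (∀ z ∈ D, ¬ (layer G side bip (!b)).Adj v z) →
        ¬ SplitColorable G side bip (n * (t + 1)) D →
        (∃ b v D, v ∉ D ∧ HasPath (layer G side bip b) t v D) ∨
        HasAlternation (layer G side bip) side bip (i + 1) s b X ∨
        HasAlternation (layer G side bip) side bip (j + 1) s' b' X := by
      intro v hv hvs D hD hvD hsep hnc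
      have hrel : s' = (s ^^ bip) ∧ b' = !!b ∨ s' = ((s ^^ bip) ^^ bip) ∧ b' = !b := by
        simpa using hs'.symm
      rcases ih i (j + 1) (by omega) D (s ^^ bip) s' (!b) b' hbip hrel hnc with h1 | h1 | h1
      · exact .inl h1
      · exact .inr (.inl ⟨v, hv, hvs, D, hD, hvD, hsep, h1⟩)
      · exact .inr (.inr (h1.mono hD))
    have snd_step : ∀ v ∈ X, side v = s' → ∀ D ⊆ X, v ∉ D →
        (∀ z ∈ D, ¬ (layer G side bip (!b')).Adj v z) →
        ¬ SplitColorable G side bip (n * (t + 1)) D →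
        (∃ b v D, v ∉ D ∧ HasPath (layer G side bip b) t v D) ∨
        HasAlternation (layer G side bip) side bip (i + 1) s b X ∨
        HasAlternation (layer G side bip) side bip (j + 1) s' b' X := by
      intro v hv hvs D hD hvD hsep hnc
      have hrel : (s' ^^ bip) = s ∧ (!b') = !b ∨ (s' ^^ bip) = (s ^^ bip) ∧ (!b') = b := by
        rcases hs' with ⟨h1, h2⟩ | ⟨h1, h2⟩ <;> simp [h1, h2]
      rcases ih (i + 1) j (by omega) D s (s' ^^ bip) b (!b') hs (by
        rcases hs' with ⟨h1, h2⟩ | ⟨h1, h2⟩ <;> simp [h1, h2]) hnc with h1 | h1 | h1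
      · exact .inl h1
      · exact .inr (.inl (h1.mono hD))
      · exact .inr (.inr ⟨v, hv, hvs, D, hD, hvD, hsep, h1⟩)
    have hbound : (n + 1) * (t + 1) = n * (t + 1) + t + 1 := by ring
    rw [hbound] at h
    generalize n * (t + 1) = M at h fst_step snd_step
    clear hbound
    -- The two unfinished alternations await the same side with opposite layers, or related sides
    -- with the same layer; extending either one swaps the cases. In the first, any vertex of the
    -- awaited side works, whichever way it splits. In the second, the path argument supplies a
    -- vertex joined in the awaited layer, and its side decides which alternation grows. A round
    -- costs at most `t + 1`.
    rcases hs' with ⟨rfl, rfl⟩ | ⟨rfl, rfl⟩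
    · obtain ⟨v, hv, hvs⟩ := SplitColorable.exists_mem_side h hs
      obtain ⟨a, ha⟩ := SplitColorable.exists_split h v
      have hnc := fun hc => ha (SplitColorable.mono (m := M) (n := M + t) hc (Nat.le_add_right M t))
      by_cases hab : a = !b
      · subst hab
        exact fst_step v hv hvs _ (fun x hx => hx.1) (fun hx => hx.2.1 rfl)
          (fun z hz => hz.2.2) hnc
      · obtain rfl : a = b := by simpa using hab
        exact snd_step v hv hvs _ (fun x hx => hx.1) (fun hx => hx.2.1 rfl)
          (fun z hz => by simpa using hz.2.2) hnc
    · obtain ⟨C, hCX, hC, hconn, -⟩ := SplitColorable.exists_component b' h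
      obtain ⟨v, hv, -⟩ := SplitColorable.exists_mem_side hC hs
      have hins : Insert.insert v (C \ {v}) = C := by
        rw [Set.insert_sdiff_singleton, Set.insert_eq_of_mem hv]
      have hD : ¬ SplitColorable G side bip (M + t) (C \ {v}) := fun hc =>
        hC (hins ▸ hc.insert v)
      rcases hasPath_or_exists_joined b' M t v (C \ {v}) (by simp) (by rwa [hins]) hD with
        h1 | ⟨u, hu, Z, hZ, huZ, hnc, hsep⟩
      · exact .inl ⟨b', v, C \ {v}, by simp, h1⟩
      · rw [hins] at hu
        have hZX : Z ⊆ X := hZ.trans (Set.sdiff_subset.trans hCX)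
        rcases hs u with hus | hus
        · exact fst_step u (hCX hu) hus Z hZX huZ hsep hnc
        · exact snd_step u (hCX hu) hus Z hZX huZ hsep hnc

end Extraction

/-! ### Excluded semi-induced subgraphs -/

/-- Adjacencies inside a side do not matter for a semi-induced subgraph, so an injection that is
correct across the sides suffices. -/
theorem not_excludesSemiInduced {V : Type u} {W : Type v} (G : SimpleGraph V) (H : BipartiteGraph W)
    (φ : W → V) (hφ : Function.Injective φ)
    (h : ∀ x y, H.side x = true → H.side y = false → (G.Adj (φ x) (φ y) ↔ H.graph.Adj x y)) :
    ¬ ExcludesSemiInduced G H := by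
  intro hex
  have hA : ∀ x, φ x ∈ φ '' {x | H.side x = true} ↔ H.side x = true := fun x => by
    simp [hφ.eq_iff]
  have hB : ∀ x, φ x ∈ φ '' {x | H.side x = false} ↔ H.side x = false := fun x => by
    simp [hφ.eq_iff]
  have hAB : Disjoint (φ '' {x | H.side x = true}) (φ '' {x | H.side x = false}) := by
    rw [Set.disjoint_image_iff hφ, Set.disjoint_left]
    intro x hx hx'
    exact absurd (hx.symm.trans hx') (by simp)
  have hmem : ∀ x, φ x ∈ φ '' {x | H.side x = true} ∪ φ '' {x | H.side x = false} := fun x => by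
    rw [Set.mem_union, hA, hB]
    cases H.side x <;> simp
  refine hex _ _ hAB ⟨⟨Equiv.ofBijective (fun x => ⟨φ x, hmem x⟩) ⟨?_, ?_⟩, ?_⟩, ?_⟩
  · exact fun x y hxy => hφ (congrArg Subtype.val hxy)
  · rintro ⟨_, ⟨x, -, rfl⟩ | ⟨x, -, rfl⟩⟩ <;> exact ⟨x, rfl⟩
  · intro x y
    change (G.Adj (φ x) (φ y) ∧ (φ x ∈ _ ∧ φ y ∈ _ ∨ φ x ∈ _ ∧ φ y ∈ _)) ↔ _
    rw [hA, hA, hB, hB]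
    have h1 := H.side.valid (v := x) (w := y)
    rcases hx : H.side x with _ | _ <;> rcases hy : H.side y with _ | _ <;> rw [hx, hy] at h1
    · simp only [reduceCtorEq, and_true, and_false, or_self, false_iff]
      exact fun h => h1 h rfl
    · rw [G.adj_comm, h y x hy hx, H.graph.adj_comm]
      simp
    · rw [h x y hx hy]
      simp
    · simp only [reduceCtorEq, and_true, and_false, or_self, false_iff]
      exact fun h => h1 h rfl
  · intro x y
    refine Iff.trans ?_ decide_eq_decide.symm
    change _ ↔ (φ x ∈ φ '' {x | H.side x = true} ↔ φ y ∈ φ '' {x | H.side x = true})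
    rw [hA, hA]
    cases H.side x <;> cases H.side y <;> simp

theorem not_hasPath {V : Type u} {G : SimpleGraph V} {side : V → Bool} {bip : Bool} {t : ℕ}
    (h1 : ExcludesSemiInduced G (BipartiteGraph.path t))
    (h2 : ExcludesSemiInduced G (BipartiteGraph.path t).bipartiteCompl) (b : Bool) {v : V}
    {D : Set V} (hv : v ∉ D) : ¬ HasPath (layer G side bip b) t v D := by
  intro h
  obtain ⟨p, -, hp, hp'⟩ := h.exists_seq hv
  have hside : ∀ i ≤ t, side (p i) = (side (p 0) ^^ (i.bodd && bip)) := by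
    intro i hi
    induction i with
    | zero => simp
    | succ i ih =>
      rw [(hp i (by omega)).2.2.1, ih (by omega), Nat.bodd_succ]
      cases side (p 0) <;> cases i.bodd <;> cases bip <;> rfl
  -- The path has `t` edges; only its first `t` vertices are needed.
  have hinj : Function.Injective fun i : Fin t => p i := by
    intro i j hij
    by_contra hne
    rcases lt_or_gt_of_ne (Fin.val_ne_of_ne hne) with hlt | hlt
    · exact (hp' i j hlt j.2.le).1 hij
    · exact (hp' j i hlt i.2.le).1 hij.symm
  have hadj : ∀ i j : ℕ, i < j → j < t → i.bodd ≠ j.bodd →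
      ((G.Adj (p i) (p j) ↔ b = true) ↔ j = i + 1) := by
    intro i j hij hj hb
    refine ⟨fun h => (hp' i j hij hj.le).2 ⟨(hp' i j hij hj.le).1, ?_, h⟩, ?_⟩
    · rw [hside i (by omega), hside j hj.le]
      rw [Bool.eq_not_of_ne hb]
      cases side (p 0) <;> cases j.bodd <;> cases bip <;> rfl
    · rintro rfl
      exact (hp i (by omega)).2.2.2
  have hadj' : ∀ i j : Fin t, (i : ℕ).bodd ≠ (j : ℕ).bodd →
      ((G.Adj (p i) (p j) ↔ b = true) ↔ (pathGraph t).Adj i j) := by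
    intro i j hb
    rw [pathGraph_adj]
    rcases lt_trichotomy (i : ℕ) j with hlt | heq | hlt
    · rw [hadj i j hlt j.2 hb]
      omega
    · exact absurd (by rw [heq]) hb
    · rw [G.adj_comm, hadj j i hlt i.2 hb.symm]
      omega
  have hcol : ∀ i j : Fin t, (BipartiteGraph.path t).side i = true →
      (BipartiteGraph.path t).side j = false → (i : ℕ).bodd ≠ (j : ℕ).bodd := by
    intro i j hi hj hb
    have hi : decide ((i : ℕ) % 2 = 0) = true := hi
    have hj : decide ((j : ℕ) % 2 = 0) = false := hj
    have h3 := Nat.mod_two_of_bodd i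
    have h4 := Nat.mod_two_of_bodd j
    rw [hb] at h3
    simp at hi hj
    omega
  cases b with
  | true =>
    refine not_excludesSemiInduced G (BipartiteGraph.path t) _ hinj (fun i j hi hj => ?_) h1
    change _ ↔ (pathGraph t).Adj i j
    simpa using hadj' i j (hcol i j hi hj)
  | false =>
    refine not_excludesSemiInduced G (BipartiteGraph.path t).bipartiteCompl _ hinj
      (fun i j hi hj => ?_) h2
    have hi : (BipartiteGraph.path t).side i = true := hi
    have hj : (BipartiteGraph.path t).side j = false := hj
    change _ ↔ (BipartiteGraph.path t).side i ≠ (BipartiteGraph.path t).side j ∧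
      ¬ (pathGraph t).Adj i j
    rw [← hadj' i j (hcol i j hi hj), hi, hj]
    simp

/-- Even positions serve as the `a_i` and odd ones as the `b_j`: position `2i` precedes `2j + 1` iff
`i ≤ j`, and the parity of the earlier position decides adjacency. The map `f` allows use in induced
subgraphs. -/
theorem not_hasAlternation {V : Type u} {U : Type v} {G : SimpleGraph V} {f : U → V}
    (hf : Function.Injective f) {side : U → Bool} {bip : Bool} {k : ℕ}
    (h : ExcludesSemiInduced G (BipartiteGraph.halfGraph k)) (s : Bool) (C : Set U) :
    ¬ HasAlternation (layer (G.comap f) side bip) side bip (2 * k) s true C := by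
  intro hC
  rcases isEmpty_or_nonempty U with hU | hU
  -- Only `k = 0` survives here, and the empty half-graph occurs in every graph.
  · rcases k with _ | k
    · exact not_excludesSemiInduced G (BipartiteGraph.halfGraph 0)
        (fun x => x.elim Fin.elim0 Fin.elim0) (fun x => x.elim Fin.elim0 Fin.elim0)
        (fun x => x.elim (fun i => i.elim0) fun i => i.elim0) h
    · obtain ⟨x, -⟩ := hC
      exact hU.elim x
  obtain ⟨q, hq, hq'⟩ := hC.exists_seq
  have hinj : ∀ i j, i < 2 * k → j < 2 * k → f (q i) = f (q j) → i = j := by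
    intro i j hi hj hij
    by_contra hne
    rcases lt_or_gt_of_ne hne with hlt | hlt
    · exact (hq' i j hlt hj).1 (hf hij)
    · exact (hq' j i hlt hi).1 (hf hij.symm)
  have hadj : ∀ i j, i < j → j < 2 * k → i.bodd ≠ j.bodd →
      (G.Adj (f (q i)) (f (q j)) ↔ i.bodd = false) := by
    intro i j hij hj hb
    have h1 := (hq' i j hij hj).2
    have h2 : side (q j) = (side (q i) ^^ bip) := by
      rw [(hq i (by omega)).2, (hq j hj).2]
      rw [Bool.eq_not_of_ne hb]
      cases s <;> cases j.bodd <;> cases bip <;> rfl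
    have h3 : ¬ (G.Adj (f (q i)) (f (q j)) ↔ (!(true ^^ i.bodd)) = true) := fun h3 =>
      h1 ⟨(hq' i j hij hj).1, h2, h3⟩
    cases hi : i.bodd <;> simpa [hi] using h3
  refine not_excludesSemiInduced G (BipartiteGraph.halfGraph k)
    (fun x => f (q (Sum.elim (fun i : Fin k => 2 * (i : ℕ)) (fun j : Fin k => 2 * (j : ℕ) + 1) x))) ?_ ?_ h
  · rintro (⟨i, hi⟩ | ⟨i, hi⟩) (⟨j, hj⟩ | ⟨j, hj⟩) hij
    all_goals
      have := hinj _ _ (by simp; omega) (by simp; omega) hij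
      simp only [Sum.elim_inl, Sum.elim_inr] at this
      first | omega | (congr 2; omega)
  · rintro (i | i) (j | j) hi hj
    · exact absurd hj Bool.noConfusion
    · change G.Adj (f (q (2 * i))) (f (q (2 * j + 1))) ↔ i ≤ j
      rcases le_or_gt i j with hij | hij
      · have : (i : ℕ) ≤ j := hij
        have := j.2
        simp [hij, hadj (2 * i) (2 * j + 1) (by omega) (by omega)]
      · have : (j : ℕ) < i := hij
        have := i.2
        rw [G.adj_comm, hadj (2 * j + 1) (2 * i) (by omega) (by omega) (by simp)]
        simp [hij]
    all_goals exact absurd hi Bool.noConfusion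

/-! ### Cosplits -/

theorem exists_splitColoring {V : Type u} [Finite V] {G : SimpleGraph V} {t k : ℕ}
    (h1 : ExcludesSemiInduced G (BipartiteGraph.path t))
    (h2 : ExcludesSemiInduced G (BipartiteGraph.path t).bipartiteCompl)
    (h3 : ExcludesSemiInduced G (BipartiteGraph.halfGraph k)) (side : V → Bool) (bip : Bool)
    (hs : ∀ x, side x = true ∨ side x = (true ^^ bip)) :
    SplitColorable G side bip ((2 * k + 2 * k) * (t + 1)) Set.univ := by
  by_contra h
  have hnot := fun s => not_hasAlternation (f := id) Function.injective_id (side := side)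
    (bip := bip) h3 s Set.univ
  -- Both alternations start with layer `true`, on related sides; either one of length `2k` gives
  -- `H_k`.
  rcases hasPath_or_hasAlternation t _ (2 * k) (2 * k) rfl Set.univ true (true ^^ bip) true true hs
    (.inr ⟨rfl, rfl⟩) h with ⟨b, v, D, hv, hp⟩ | h | h
  · exact not_hasPath h1 h2 b hv hp
  · exact hnot _ h
  · exact hnot _ h

theorem isCograph_induce {V : Type u} {G : SimpleGraph V} {k : ℕ} {A : Set V} (hA : A.Nonempty)
    (h : ExcludesSemiInduced G (BipartiteGraph.halfGraph k))
    (hd : Decomposable (layer G (fun _ => true) false) A) : IsCograph (G.induce A) (4 * k) := by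
  have := hA.to_subtype
  have hd' : Decomposable (layer (G.comap ((↑) : A → V)) (fun _ => true) false) Set.univ := by
    have h1 := hd.preimage (f := ((↑) : A → V)) Subtype.val_injective
    rw [Subtype.coe_preimage_self] at h1
    exact h1.mono_layers fun b x _ y _ hxy => ⟨Subtype.val_injective.ne hxy.1, hxy.2⟩
  obtain ⟨M, hM, e, -, he⟩ := exists_treeModel (G.comap ((↑) : A → V)) (fun _ => true) false hd'
    (s := true) (fun _ => .inl rfl) k (not_hasAlternation Subtype.val_injective h _ _)
    (not_hasAlternation Subtype.val_injective h _ _) (fun _ => ()) (fun _ _ => true)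
    (fun _ _ => rfl) (by simp)
  refine ⟨M, hM, ⟨⟨e.symm, ?_⟩⟩⟩
  intro a b
  have h1 := he (e.symm a) (e.symm b)
  simp only [Equiv.apply_symm_apply] at h1
  rw [h1]
  simp [SimpleGraph.induce]

open Classical in
theorem isBiCograph_semiInduced {V : Type u} {G : SimpleGraph V} {k : ℕ} {A B : Set V}
    (hA : A.Nonempty) (hAB : Disjoint A B)
    (h : ExcludesSemiInduced G (BipartiteGraph.halfGraph k))
    (hd : Decomposable (layer G (fun x => decide (x ∈ A)) true) (A ∪ B)) :
    IsBiCograph (semiInduced G A B hAB) (4 * k) := by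
  have : Nonempty (A ∪ B : Set V) := (hA.mono Set.subset_union_left).to_subtype
  let f : (A ∪ B : Set V) → V := (↑)
  let side : (A ∪ B : Set V) → Bool := fun x => decide (x.1 ∈ A)
  have hd' : Decomposable (layer (G.comap f) side true) Set.univ := by
    have h1 := hd.preimage (f := f) Subtype.val_injective
    rw [Subtype.coe_preimage_self] at h1
    exact h1.mono_layers fun b x _ y _ hxy => ⟨Subtype.val_injective.ne hxy.1, hxy.2⟩
  obtain ⟨M, hM, e, hcol, he⟩ := exists_treeModel (G.comap f) side true hd'
    (s := true) (fun x => by cases side x <;> simp) k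
    (not_hasAlternation Subtype.val_injective h _ _)
    (not_hasAlternation Subtype.val_injective h _ _) side (fun c d => c ^^ d)
    Bool.xor_comm (fun x y => by cases side x <;> cases side y <;> simp)
  refine ⟨M, hM, ⟨e.symm, ?_⟩, fun a => ?_⟩
  · intro a b
    have h1 := he (e.symm a) (e.symm b)
    simp only [Equiv.apply_symm_apply] at h1
    rw [h1]
    generalize e.symm a = x
    generalize e.symm b = y
    change (G.Adj x y ∧ (x.1 ∈ A ∧ y.1 ∈ B ∨ x.1 ∈ B ∧ y.1 ∈ A)) ↔
      decide (y.1 ∈ A) = (decide (x.1 ∈ A) ^^ true) ∧ G.Adj x y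
    have hB : ∀ z : (A ∪ B : Set V), z.1 ∈ B ↔ z.1 ∉ A := fun z =>
      ⟨fun hz hz' => Set.disjoint_left.1 hAB hz' hz, fun hz => z.2.resolve_left hz⟩
    rw [hB, hB]
    by_cases hx : x.1 ∈ A <;> by_cases hy : y.1 ∈ A <;> simp [hx, hy]
  · have h1 := hcol (e.symm a)
    rw [Equiv.apply_symm_apply] at h1
    exact h1.symm

end Cosplit

/-! ### Assembling the 2-cosplit -/

theorem mainTheorem3 (t k : ℕ) :
    ∃ N : ℕ, ∀ (V : Type u) [Finite V] (G : SimpleGraph V),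
      Cosplit.ExcludesSemiInduced G (Cosplit.BipartiteGraph.path t) →
      Cosplit.ExcludesSemiInduced G (Cosplit.BipartiteGraph.path t).bipartiteCompl →
      Cosplit.ExcludesSemiInduced G (Cosplit.BipartiteGraph.halfGraph k) →
      ∃ P : Set (Set V), Cosplit.IsTwoCosplit G P (4 * k) ∧ P.encard ≤ (N : ℕ∞) := by
  classical
  let K : Type := Cosplit.SplitColor ((2 * k + 2 * k) * (t + 1))
  have hK : Finite K := Cosplit.SplitColor.finite _
  refine ⟨Nat.card (K × (K → K)), fun V _ G h1 h2 h3 => ?_⟩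
  obtain ⟨c, hc⟩ := Cosplit.exists_splitColoring h1 h2 h3 (fun _ => true) false fun _ => .inl rfl
  have hbi := fun i : K => Cosplit.exists_splitColoring h1 h2 h3 (fun x => decide (c x = i)) true
    fun x => by cases decide (c x = i) <;> simp
  choose d hd using hbi
  let col : V → K × (K → K) := fun x => (c x, fun i => d i x)
  let S : Setoid V := Setoid.ker col
  have hcls : ∀ A ∈ S.classes, ∃ y ∈ A, ∀ x ∈ A, col x = col y := by
    rintro _ ⟨y, rfl⟩
    exact ⟨y, S.refl y, fun x hx => hx⟩
  have hmono : ∀ i, ∀ A : Set V, (∀ x ∈ A, c x = i) →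
      Cosplit.Decomposable (Cosplit.layer G (fun _ => true) false) A := by
    intro i A hA
    exact (hc fun _ => i).subset fun x hx => ⟨trivial, hA x hx⟩
  refine ⟨S.classes, ⟨⟨Setoid.isPartition_classes S, fun A hA => ?_⟩, ?_⟩, ?_⟩
  · obtain ⟨y, hy, hA'⟩ := hcls A hA
    exact Cosplit.isCograph_induce ⟨y, hy⟩ h3
      (hmono (c y) A fun x hx => congrArg Prod.fst (hA' x hx))
  · intro A hA B hB _ hAB
    obtain ⟨y, hy, hA'⟩ := hcls A hA
    obtain ⟨z, hz, hB'⟩ := hcls B hB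
    refine Cosplit.isBiCograph_semiInduced ⟨y, hy⟩ hAB h3 ?_
    -- If both parts lie in one class of `c`, their union is already decomposable, and passing to
    -- pairs across the two parts only removes edges from the layers.
    by_cases hyz : c z = c y
    · refine (hmono (c y) (A ∪ B) ?_).mono_layers ?_
      · rintro x (hx | hx)
        · exact congrArg Prod.fst (hA' x hx)
        · exact (congrArg Prod.fst (hB' x hx)).trans hyz
      · exact fun b x _ x' _ hxx => ⟨hxx.1, rfl, hxx.2.2⟩
    -- On `A ∪ B`, the bipartition "colour `c y` against the rest" is the bipartition into `A` and
    -- `B`, so the single colouring `d (c y)` handles this pair.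
    · have hside : ∀ x ∈ A ∪ B, decide (c x = c y) = decide (x ∈ A) := by
        rintro x (hx | hx)
        · have : c x = c y := congrArg Prod.fst (hA' x hx)
          simp [this, hx]
        · have h4 : c x = c z := congrArg Prod.fst (hB' x hx)
          have h5 : x ∉ A := fun h => Set.disjoint_left.1 hAB h hx
          simp [h4, hyz, h5]
      refine ((hd (c y) fun s => if s then d (c y) y else d (c y) z).subset ?_).mono_layers ?_
        (X := A ∪ B)
      · intro x hx
        refine ⟨trivial, ?_⟩
        beta_reduce
        rw [hside x hx]
        rcases hx with hx | hx
        · simpa [hx] using congrFun (congrArg Prod.snd (hA' x hx)) (c y)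
        · have h5 : x ∉ A := fun h => Set.disjoint_left.1 hAB h hx
          simpa [h5] using congrFun (congrArg Prod.snd (hB' x hx)) (c y)
      · intro b x hx x' hx' hxx
        refine ⟨hxx.1, ?_, hxx.2.2⟩
        beta_reduce
        rw [hside x hx, hside x' hx']
        exact hxx.2.1
  · have h4 : S.classes ⊆ Set.range fun p => {x | col x = p} := by
      rintro _ ⟨y, rfl⟩
      exact ⟨col y, rfl⟩
    refine (Set.encard_le_encard h4).trans ?_
    rw [← Set.image_univ]
    refine (Set.encard_image_le _ _).trans ?_
    rw [Set.encard_univ, ENat.card_eq_coe_natCard]
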